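/- Let $d\ge 0$ and let $f_0,f_1$ be two smooth ($C^\infty$) vector fields on $\mathbb R^d$ with $f_0(0)=f_1(0)=0$. Let $V:\mathbb R^d\to[0,+\infty)$ be a smooth common weak Lyapunov function for $f_0$ and $f_1$: $V(0)=0$, $V(x)>0$ for $x\neq 0$, and, for $i=0,1$, the Lie derivative $L_{f_i}V(x)=dV(x)\cdot f_i(x)$ satisfies $L_{f_i}V(x)\le 0$ for all $x\in\mathbb R^d$. Put $\mathcal K_i=\{x\in\mathbb R^d : L_{f_i}V(x)=0\}$. An input is a piecewise constant, right-continuous function $u:[0,+\infty)\to\{0,1\}$, i.e. there are times $0=a_0<a_1<a_2<\cdots$ with $a_n\to+\infty$ such that $u$ is constant on each $[a_n,a_{n+1})$. For $x\in\mathbb R^d$, $\Phi_u(\cdot,x)$ denotes the (continuous, piecewise differentiable) solution of $\dot y=f_{u(t)}(y)$, $y(0)=x$. The vector field $f_i$ is globally asymptotically stable (GAS) at the origin if the solutions of $\dot y=f_i(y)$ satisfy: for every $\delta>0$ there is $\varepsilon>0$ such that every solution with $\|y(0)\|\le\varepsilon$ is defined for all $t\ge0$ with $\|y(t)\|\le\delta$;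 and every solution is defined for all $t\ge 0$ and converges to $0$ as $t\to+\infty$. Assume that $f_0$ and $f_1$ are GAS at the origin and that $V$ is radially unbounded, i.e. $V(x)\to+\infty$ as $\|x\|\to+\infty$. If $\mathcal K_0\cap\mathcal K_1=\{0\}$, then the switched system $\dot x=f_u(x)$, $u\in\{0,1\}$, is globally uniformly asymptotically stable (GUAS) at the origin, i.e. every solution $\Phi_u(\cdot,x)$ is defined on $[0,+\infty)$, and 1. (uniform stability) for every $\delta>0$ there is $\varepsilon>0$ such that $\|\Phi_u(t,x)\|\le\delta$ for all $x$ with $\|x\|\le\varepsilon$, all inputs $u$ and all $t\ge0$; 2. (global uniform attractivity) for all $\varepsilon,\delta>0$ there is $T>0$ such that $\|\Phi_u(t,x)\|\le\varepsilon$ for all $x$ with $\|x\|\le\delta$, all inputs $u$ and all $t\ge T$. -/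

import Mathlib

open Set Filter Topology
open scoped ContDiff

namespace SwitchedSystem

/-- An input (switching signal) with values in `ι`, given as `u = (a_n, u_n)_{n ≥ 0}`: the times
`a_n` start at `0` and increase strictly to `+∞`, and the piecewise constant right-continuous
function `u : [0, +∞) → ι` is equal to `u_n` on `[a_n, a_{n+1})`. Consecutive values may agree,
so functions with finitely many discontinuities are covered as well. -/
structure Input (ι : Type*) where
  /-- the times `a_n` -/
  time : ℕ → ℝ
  /-- the values `u_n` -/
  value : ℕ → ι
  time_zero : time 0 = 0
  time_strictMono : StrictMono time
  time_tendsto : Tendsto time atTop atTop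

variable {E : Type*} [NormedAddCommGroup E] [NormedSpace ℝ E] {ι : Type*}

/-- `φ` is a solution, defined on `[0, +∞)`, of `ẋ = f(x)`, `x(0) = x₀`.
Only the values of `φ` on `[0, +∞)` matter. -/
def IsSolution (f : E → E) (x₀ : E) (φ : ℝ → E) : Prop :=
  φ 0 = x₀ ∧ ∀ t, 0 ≤ t → HasDerivWithinAt φ (f (φ t)) (Ici 0) t

/-- `φ` is a solution, defined on `[0, +∞)`, of `ẋ = f_{u(t)}(x)`, `x(0) = x₀`: on each
`[a_n, a_{n+1}]` it solves `ẋ = f_{u_n}(x)` (with one-sided derivatives at the end points);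
in particular `φ` is continuous on `[0, +∞)`. -/
def IsSwitchedSolution (f : ι → E → E) (u : Input ι) (x₀ : E) (φ : ℝ → E) : Prop :=
  φ 0 = x₀ ∧ ∀ n : ℕ, ∀ t ∈ Icc (u.time n) (u.time (n + 1)),
    HasDerivWithinAt φ (f (u.value n) (φ t)) (Icc (u.time n) (u.time (n + 1))) t

/-- The vector field `f` is globally asymptotically stable (GAS) at the origin: stable and globally
attractive, the solutions concerned being defined for all nonnegative times. -/
def IsGAS (f : E → E) : Prop :=
  (∀ δ : ℝ, 0 < δ → ∃ ε : ℝ, 0 < ε ∧ ∀ x₀ : E, ‖x₀‖ ≤ ε →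
    (∃ φ, IsSolution f x₀ φ) ∧
      ∀ φ, IsSolution f x₀ φ → ∀ t, 0 ≤ t → ‖φ t‖ ≤ δ) ∧
  (∀ x₀ : E, (∃ φ, IsSolution f x₀ φ) ∧
    ∀ φ, IsSolution f x₀ φ → Tendsto φ atTop (𝓝 0))

/-- The switched system `ẋ = f_u(x)` is uniformly stable at the origin. -/
def IsUniformlyStable (f : ι → E → E) : Prop :=
  ∀ δ : ℝ, 0 < δ → ∃ ε : ℝ, 0 < ε ∧ ∀ x₀ : E, ‖x₀‖ ≤ ε → ∀ u : Input ι,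
    (∃ φ, IsSwitchedSolution f u x₀ φ) ∧
      ∀ φ, IsSwitchedSolution f u x₀ φ → ∀ t, 0 ≤ t → ‖φ t‖ ≤ δ

/-- The switched system `ẋ = f_u(x)` is globally uniformly attractive at the origin: the time `T`
depends neither on the initial condition in the ball of radius `δ` nor on the input. -/
def IsGloballyUniformlyAttractive (f : ι → E → E) : Prop :=
  ∀ ε δ : ℝ, 0 < ε → 0 < δ → ∃ T : ℝ, 0 < T ∧ ∀ x₀ : E, ‖x₀‖ ≤ δ → ∀ u : Input ι,
    (∃ φ, IsSwitchedSolution f u x₀ φ) ∧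
      ∀ φ, IsSwitchedSolution f u x₀ φ → ∀ t, T ≤ t → ‖φ t‖ ≤ ε

/-- The switched system `ẋ = f_u(x)` is globally uniformly asymptotically stable (GUAS) at the
origin. -/
def IsGUAS (f : ι → E → E) : Prop :=
  IsUniformlyStable f ∧ IsGloballyUniformlyAttractive f

/-- The Lie derivative of `V` along the vector field `f`. -/
noncomputable def lieDeriv (f : E → E) (V : E → ℝ) (x : E) : ℝ :=
  fderiv ℝ V x (f x)

/-- `V` is a smooth weak common Lyapunov function for the vector fields `f_i`. -/
structure IsWeakCommonLyapunov (f : ι → E → E) (V : E → ℝ) : Prop where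
  smooth : ContDiff ℝ ∞ V
  map_zero : V 0 = 0
  pos : ∀ x, x ≠ 0 → 0 < V x
  lieDeriv_nonpos : ∀ i x, lieDeriv (f i) V x ≤ 0

/-- `V(x) → +∞` as `‖x‖ → +∞`. -/
def IsRadiallyUnbounded (V : E → ℝ) : Prop :=
  Tendsto V (comap (fun x : E => ‖x‖) atTop) atTop

/-- The set of points where the Lie derivative of `V` along `f` vanishes. -/
def lieZeroSet (f : E → E) (V : E → ℝ) : Set E :=
  {x | lieDeriv f V x = 0}

end SwitchedSystem

/-! `V` never increases along a trajectory, so stability is immediate, and attractivity reduces to a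
uniform decrease of `V` on compact shells `r ≤ V ≤ R`, `r > 0`.

On such a shell the two Lie derivatives have no common zero, so the sets where each is small are
disjoint compact sets. A smooth `q` equal to 0 on one and 1 on the other (`exists_separating`)
varies only where both fields make `V` decrease at a definite rate, so its variation is at most a
constant times the drop of `V` (`abs_sub_le`). If `V` drops little, `q` stays below 1 or above 0,
and one of the fields, whenever active, costs `V` at rate at least `ρ`. That field is then active
only briefly, so by a Gronwall estimate (`norm_sub_le`) the trajectory shadows the other field,
which is GAS and brings `V` below `r`.

Compactness makes the time and the drop uniform (`exists_decrease_of_isGAS`). Hence over a fixed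
time `V` falls below `r` or loses a fixed amount (`exists_decrease`), and iteration concludes. -/

namespace SwitchedSystem

/-! ### Trajectories, monotonicity of `V`, and comparison estimates -/

section Trajectories

variable {E : Type*} [NormedAddCommGroup E] [NormedSpace ℝ E] {ι : Type*}

/-- A continuous curve on `[0, +∞)` whose right derivative at every time is the value of one of the
vector fields `f i`. -/
def IsForwardTrajectory (f : ι → E → E) (φ : ℝ → E) : Prop :=
  ContinuousOn φ (Ici 0) ∧ ∀ t, 0 ≤ t → ∃ i, HasDerivWithinAt φ (f i (φ t)) (Ici t) t

theorem IsSolution.isForwardTrajectory {f : ι → E → E} {i : ι} {x₀ : E} {φ : ℝ → E}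
    (h : IsSolution (f i) x₀ φ) : IsForwardTrajectory f φ :=
  ⟨fun t ht => (h.2 t ht).continuousWithinAt, fun t ht =>
    ⟨i, (h.2 t ht).mono (Ici_subset_Ici.2 ht)⟩⟩

theorem Input.exists_mem_Ico (u : Input ι) {t : ℝ} (ht : 0 ≤ t) :
    ∃ n, t ∈ Ico (u.time n) (u.time (n + 1)) := by
  classical
  have hex : ∃ n, t < u.time (n + 1) := by
    obtain ⟨n, hn⟩ := (u.time_tendsto.eventually_gt_atTop t).exists
    exact ⟨n, hn.trans (u.time_strictMono n.lt_succ_self)⟩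
  refine ⟨Nat.find hex, ?_, Nat.find_spec hex⟩
  rcases h : Nat.find hex with _ | m
  · rw [u.time_zero]; exact ht
  · exact not_lt.1 (Nat.find_min hex (h ▸ m.lt_succ_self))

theorem Input.eq_of_mem_Ico (u : Input ι) {t : ℝ} {m n : ℕ}
    (hm : t ∈ Ico (u.time m) (u.time (m + 1))) (hn : t ∈ Ico (u.time n) (u.time (n + 1))) :
    m = n := by
  have h1 := u.time_strictMono.lt_iff_lt.1 (hm.1.trans_lt hn.2)
  have h2 := u.time_strictMono.lt_iff_lt.1 (hn.1.trans_lt hm.2)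
  omega

theorem Input.time_nonneg (u : Input ι) (n : ℕ) : 0 ≤ u.time n :=
  u.time_zero ▸ u.time_strictMono.monotone n.zero_le

theorem IsSwitchedSolution.hasDerivWithinAt_Ici {f : ι → E → E} {u : Input ι} {x₀ : E}
    {φ : ℝ → E} (h : IsSwitchedSolution f u x₀ φ) {n : ℕ} {t : ℝ}
    (ht : t ∈ Ico (u.time n) (u.time (n + 1))) :
    HasDerivWithinAt φ (f (u.value n) (φ t)) (Ici t) t :=
  (h.2 n t (Ico_subset_Icc_self ht)).mono_of_mem_nhdsWithin
    (mem_of_superset (Icc_mem_nhdsGE ht.2) (Icc_subset_Icc_left ht.1))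

theorem IsSwitchedSolution.isForwardTrajectory {f : ι → E → E} {u : Input ι} {x₀ : E}
    {φ : ℝ → E} (h : IsSwitchedSolution f u x₀ φ) : IsForwardTrajectory f φ := by
  refine ⟨fun t ht => ?_, fun t ht => ?_⟩
  · obtain ⟨n, hn⟩ := u.exists_mem_Ico ht
    have hr := (h.hasDerivWithinAt_Ici hn).continuousWithinAt
    rcases hn.1.eq_or_lt with he | hlt
    · rcases n with _ | m
      · rw [u.time_zero] at he
        rwa [he]
      · have hl := h.2 m t (he ▸ right_mem_Icc.2 (u.time_strictMono m.lt_succ_self).le)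
        have hl' : ContinuousWithinAt φ (Iic t) t :=
          hl.continuousWithinAt.mono_of_mem_nhdsWithin
            (he ▸ Icc_mem_nhdsLE (u.time_strictMono m.lt_succ_self))
        exact (continuousAt_iff_continuous_left_right.2 ⟨hl', hr⟩).continuousWithinAt
    · exact ((h.2 n t (Ico_subset_Icc_self hn)).continuousWithinAt.continuousAt
        (Icc_mem_nhds hlt hn.2)).continuousWithinAt
  · obtain ⟨n, hn⟩ := u.exists_mem_Ico ht
    exact ⟨_, h.hasDerivWithinAt_Ici hn⟩

/-- Restarting at a later time stays within this class of curves, so estimates can be iterated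
without shifting inputs. -/
theorem IsForwardTrajectory.comp_add_const {f : ι → E → E} {φ : ℝ → E}
    (h : IsForwardTrajectory f φ) {s : ℝ} (hs : 0 ≤ s) :
    IsForwardTrajectory f (fun t => φ (t + s)) := by
  refine ⟨h.1.comp (by fun_prop) fun t ht => add_nonneg ht hs, fun t ht => ?_⟩
  obtain ⟨i, hi⟩ := h.2 (t + s) (add_nonneg ht hs)
  refine ⟨i, ?_⟩
  have := HasDerivWithinAt.scomp t hi ((hasDerivWithinAt_id t (Ici t)).add_const s)
    (fun x hx => add_le_add_left hx s)
  simpa [Function.comp_def] using this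

theorem exists_isSwitchedSolution {f : ι → E → E}
    (hex : ∀ i x₀, ∃ φ, IsSolution (f i) x₀ φ) (u : Input ι) (x₀ : E) :
    ∃ φ, IsSwitchedSolution f u x₀ φ := by
  choose S hS0 hS using hex
  choose! N hN using fun t (ht : 0 ≤ t) => u.exists_mem_Ico ht
  -- `X n` is the state at the switching time `a_n`; the solutions of the individual fields are
  -- concatenated.
  let X : ℕ → E := fun n =>
    n.rec x₀ fun n x => S (u.value n) x (u.time (n + 1) - u.time n)
  have hX : ∀ n, X (n + 1) = S (u.value n) (X n) (u.time (n + 1) - u.time n) := fun n => rfl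
  let φ : ℝ → E := fun t => S (u.value (N t)) (X (N t)) (t - u.time (N t))
  have hlt : ∀ n, u.time n < u.time (n + 1) := fun n => u.time_strictMono n.lt_succ_self
  have hNeq : ∀ {n t}, t ∈ Ico (u.time n) (u.time (n + 1)) → N t = n := fun {n t} ht =>
    u.eq_of_mem_Ico (hN t ((u.time_nonneg n).trans ht.1)) ht
  have hφ' : ∀ n, φ (u.time n) = X n := fun n => by
    simp only [φ, hNeq (left_mem_Ico.2 (hlt n)), sub_self, hS0]
  have hφ : ∀ n, ∀ t ∈ Icc (u.time n) (u.time (n + 1)),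
      φ t = S (u.value n) (X n) (t - u.time n) := by
    intro n t ht
    -- At the right end point `φ` is defined by the next piece, which starts at `X (n + 1)`, the end
    -- value of the present one.
    rcases ht.2.eq_or_lt with rfl | h
    · rw [hφ', hX]
    · simp only [φ, hNeq ⟨ht.1, h⟩]
  refine ⟨φ, ?_, fun n t ht => ?_⟩
  · exact u.time_zero ▸ hφ' 0
  · rw [hφ n t ht]
    refine HasDerivWithinAt.congr_of_mem ?_ (hφ n) ht
    have := HasDerivWithinAt.scomp t (hS (u.value n) (X n) (t - u.time n) (sub_nonneg.2 ht.1))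
      ((hasDerivWithinAt_id t (Icc (u.time n) (u.time (n + 1)))).sub_const (u.time n))
      (fun x hx => sub_nonneg.2 hx.1)
    simpa [Function.comp_def] using this

variable {f : ι → E → E} {V : E → ℝ} {φ : ℝ → E}

theorem IsWeakCommonLyapunov.differentiable (hV : IsWeakCommonLyapunov f V) :
    Differentiable ℝ V :=
  hV.smooth.differentiable (by simp)

theorem IsWeakCommonLyapunov.antitoneOn (hV : IsWeakCommonLyapunov f V)
    (hφ : IsForwardTrajectory f φ) : AntitoneOn (fun t => V (φ t)) (Ici 0) := by
  intro s hs t _ hst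
  have : Nonempty ι := (hφ.2 0 le_rfl).nonempty
  choose! σ hσ using hφ.2
  refine image_le_of_deriv_right_le_deriv_boundary
    (f' := fun t => lieDeriv (f (σ t)) V (φ t)) (B := fun _ => V (φ s)) (B' := fun _ => 0)
    (hV.smooth.continuous.comp_continuousOn (hφ.1.mono fun x hx => hs.out.trans hx.1))
    (fun x hx => ?_) le_rfl continuousOn_const (fun x _ => hasDerivWithinAt_const ..)
    (fun x _ => hV.lieDeriv_nonpos _ _) ⟨hst, le_rfl⟩
  exact (hV.differentiable _).hasFDerivAt.comp_hasDerivWithinAt x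
    (hσ x (hs.out.trans hx.1))

theorem IsWeakCommonLyapunov.le_initial (hV : IsWeakCommonLyapunov f V)
    (hφ : IsForwardTrajectory f φ) {t : ℝ} (ht : 0 ≤ t) : V (φ t) ≤ V (φ 0) :=
  hV.antitoneOn hφ self_mem_Ici ht ht

/-- A function whose Lie derivatives are dominated by those of `V` varies along a trajectory at most
as much as `V`. -/
theorem IsWeakCommonLyapunov.abs_sub_le (hV : IsWeakCommonLyapunov f V)
    (hφ : IsForwardTrajectory f φ) {q : E → ℝ} (hq : Differentiable ℝ q) {C T : ℝ}
    (hC : ∀ t ∈ Ico 0 T, ∀ i, |lieDeriv (f i) q (φ t)| ≤ C * -lieDeriv (f i) V (φ t))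
    {t : ℝ} (ht : t ∈ Icc 0 T) :
    |q (φ t) - q (φ 0)| ≤ C * (V (φ 0) - V (φ t)) := by
  have : Nonempty ι := (hφ.2 0 le_rfl).nonempty
  choose! σ hσ using hφ.2
  have hc : ContinuousOn φ (Icc 0 T) := hφ.1.mono Icc_subset_Ici_self
  refine image_norm_le_of_norm_deriv_right_le_deriv_boundary'
    (f := fun t => q (φ t) - q (φ 0)) (f' := fun t => lieDeriv (f (σ t)) q (φ t))
    (B := fun t => C * (V (φ 0) - V (φ t)))
    (B' := fun t => C * -lieDeriv (f (σ t)) V (φ t))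
    ((hq.continuous.comp_continuousOn hc).sub continuousOn_const) (fun x hx => ?_) (by simp)
    (continuousOn_const.mul (continuousOn_const.sub (hV.smooth.continuous.comp_continuousOn hc)))
    (fun x hx => ?_) (fun x hx => hC x hx _) ht
  · exact ((hq _).hasFDerivAt.comp_hasDerivWithinAt x (hσ x hx.1)).sub_const _
  · exact (((hV.differentiable _).hasFDerivAt.comp_hasDerivWithinAt x
      (hσ x hx.1)).const_sub _).const_mul _

/-- If, along a trajectory `φ`, the vector fields other than `f i` make `V` decrease at a rate at
least `ρ`, then `φ` stays close to a trajectory of `f i` as long as `V` decreases little. -/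
theorem IsWeakCommonLyapunov.norm_sub_le (hV : IsWeakCommonLyapunov f V)
    (hφ : IsForwardTrajectory f φ) {i : ι} {x : E} {ψ : ℝ → E} (hψ : IsSolution (f i) x ψ)
    {S : Set E} {L : NNReal} (hL : LipschitzOnWith L (f i) S) {M ρ ε T : ℝ} (hρ : 0 < ρ)
    (hε : 0 < ε) (hM0 : 0 ≤ M) (hM : ∀ j, ∀ y ∈ S, ‖f j y - f i y‖ ≤ M)
    (hφS : ∀ t, 0 ≤ t → φ t ∈ S) (hψS : ∀ t, 0 ≤ t → ψ t ∈ S)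
    (hdec : ∀ t ∈ Icc 0 T, ∀ j, j ≠ i → ρ ≤ -lieDeriv (f j) V (φ t))
    (h0 : ‖φ 0 - x‖ ≤ ε) {t : ℝ} (ht : t ∈ Icc 0 T) :
    ‖φ t - ψ t‖ ≤ Real.exp ((L + 1) * t) * (M / ρ * (V (φ 0) - V (φ t)) + ε) := by
  have : Nonempty ι := (hφ.2 0 le_rfl).nonempty
  choose! σ hσ using hφ.2
  have hc : ContinuousOn φ (Icc 0 T) := hφ.1.mono Icc_subset_Ici_self
  have hVc : ContinuousOn (fun t => V (φ t)) (Icc 0 T) :=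
    hV.smooth.continuous.comp_continuousOn hc
  -- The strict inequality of derivatives is needed only where the norm equals the bound `B`; the
  -- rate `L + 1` instead of `L`, with `B > 0` thanks to `ε`, supplies it.
  refine image_norm_le_of_norm_deriv_right_lt_deriv_boundary'
    (f := fun t => φ t - ψ t) (f' := fun t => f (σ t) (φ t) - f i (ψ t))
    (B := fun t => Real.exp ((L + 1) * t) * (M / ρ * (V (φ 0) - V (φ t)) + ε))
    (B' := fun t => Real.exp ((L + 1) * t) * (L + 1) * (M / ρ * (V (φ 0) - V (φ t)) + ε)
      + Real.exp ((L + 1) * t) * (M / ρ * -lieDeriv (f (σ t)) V (φ t)))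
    (hc.sub fun s hs => ((hψ.2 s hs.1).continuousWithinAt.mono Icc_subset_Ici_self))
    (fun s hs => (hσ s hs.1).sub ((hψ.2 s hs.1).mono (Ici_subset_Ici.2 hs.1)))
    (by simpa [hψ.1] using h0)
    ((show Continuous fun t : ℝ => Real.exp ((L + 1) * t) by fun_prop).continuousOn.mul
      ((continuousOn_const.mul (continuousOn_const.sub hVc)).add continuousOn_const)) (fun s hs => ?_) (fun s hs hB => ?_) ht
  · have h1 : HasDerivWithinAt (fun t : ℝ => Real.exp ((L + 1) * t))
        (Real.exp ((L + 1) * s) * (L + 1)) (Ici s) s := by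
      simpa using (((hasDerivAt_id s).const_mul ((L : ℝ) + 1)).exp).hasDerivWithinAt
    exact h1.mul (((((hV.differentiable _).hasFDerivAt.comp_hasDerivWithinAt s
      (hσ s hs.1)).const_sub _).const_mul _).add_const _)
  · have hexp : 1 ≤ Real.exp ((L + 1) * s) := Real.one_le_exp (by have := hs.1; positivity)
    have hdrop : 0 ≤ V (φ 0) - V (φ s) := sub_nonneg.2 (hV.le_initial hφ hs.1)
    have hBpos : 0 < Real.exp ((L + 1) * s) * (M / ρ * (V (φ 0) - V (φ s)) + ε) := by positivity
    have hW : 0 ≤ -lieDeriv (f (σ s)) V (φ s) := neg_nonneg.2 (hV.lieDeriv_nonpos _ _)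
    -- The error of using a field other than `f i` is charged to the decrease of `V` it causes.
    have h1 : ‖f (σ s) (φ s) - f i (φ s)‖ ≤ M / ρ * -lieDeriv (f (σ s)) V (φ s) := by
      by_cases hi : σ s = i
      · rw [hi] at hW ⊢
        simp only [sub_self, norm_zero]
        positivity
      · calc _ ≤ M := hM _ _ (hφS s hs.1)
          _ = M / ρ * ρ := by field_simp
          _ ≤ _ := by gcongr; exact hdec s (Ico_subset_Icc_self hs) _ hi
    have h2 : M / ρ * -lieDeriv (f (σ s)) V (φ s)
        ≤ Real.exp ((L + 1) * s) * (M / ρ * -lieDeriv (f (σ s)) V (φ s)) :=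
      le_mul_of_one_le_left (by positivity) hexp
    have h3 : ‖f i (φ s) - f i (ψ s)‖ ≤ L * ‖φ s - ψ s‖ :=
      hL.norm_sub_le (hφS s hs.1) (hψS s hs.1)
    have h4 := norm_sub_le_norm_sub_add_norm_sub (f (σ s) (φ s)) (f i (φ s)) (f i (ψ s))
    rw [hB] at h3
    nlinarith

theorem continuous_lieDeriv {g : E → E} {q : E → ℝ} (hg : Continuous g) (hq : ContDiff ℝ ∞ q) :
    Continuous (lieDeriv g q) :=
  (hq.continuous_fderiv (by simp)).clm_apply hg

end Trajectories

/-! ### Compact sublevel sets and uniform shadowing of a GAS field -/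

section FiniteDimensional

variable {E : Type*} [NormedAddCommGroup E] [NormedSpace ℝ E] [FiniteDimensional ℝ E]

theorem IsRadiallyUnbounded.isCompact_setOf_le {V : E → ℝ} (h : IsRadiallyUnbounded V)
    (hc : Continuous V) (R : ℝ) : IsCompact {x | V x ≤ R} := by
  have : ProperSpace E := FiniteDimensional.proper ℝ E
  refine Metric.isCompact_of_isClosed_isBounded (isClosed_le hc continuous_const) ?_
  have h1 : {x | R < V x} ∈ Bornology.cobounded E := by
    rw [← comap_norm_atTop]
    exact h.eventually_gt_atTop R
  simpa [Bornology.isBounded_def, compl_def] using h1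

variable {ι : Type*} {f : ι → E → E} {V : E → ℝ}

theorem IsWeakCommonLyapunov.exists_norm_le (hV : IsWeakCommonLyapunov f V)
    (hVunb : IsRadiallyUnbounded V) {δ : ℝ} (hδ : 0 < δ) :
    ∃ r > 0, ∀ x, V x ≤ r → ‖x‖ ≤ δ := by
  have hc := hV.smooth.continuous
  have hK : IsCompact ({x | V x ≤ 1} ∩ {x | δ ≤ ‖x‖}) :=
    (hVunb.isCompact_setOf_le hc 1).inter_right (isClosed_le continuous_const continuous_norm)
  rcases eq_empty_or_nonempty ({x | V x ≤ 1} ∩ {x | δ ≤ ‖x‖}) with he | hne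
  · refine ⟨1, one_pos, fun x hx => le_of_not_ge fun hx' => ?_⟩
    exact (he ▸ (⟨hx, hx'⟩ : x ∈ {x | V x ≤ 1} ∩ {x | δ ≤ ‖x‖}) : x ∈ (∅ : Set E))
  · obtain ⟨x₀, hx₀, hmin⟩ := hK.exists_isMinOn hne hc.continuousOn
    have hpos : 0 < V x₀ := hV.pos x₀ (norm_pos_iff.1 (hδ.trans_le hx₀.2))
    refine ⟨min 1 (V x₀ / 2), by positivity, fun x hx => le_of_not_gt fun hx' => ?_⟩
    have h1 : V x₀ ≤ V x := hmin ⟨hx.trans (min_le_left ..), hx'.le⟩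
    have h2 := hx.trans (min_le_right ..)
    linarith

/-- Uniform decrease along trajectories that follow `f i` up to arcs on which `V` decreases at a
rate at least `ρ`. -/
theorem IsWeakCommonLyapunov.exists_decrease_of_isGAS [Finite ι] (hV : IsWeakCommonLyapunov f V)
    (hVunb : IsRadiallyUnbounded V) (hf : ∀ i, ContDiff ℝ ∞ (f i)) {i : ι} (hi : IsGAS (f i))
    {r R ρ : ℝ} (hr : 0 < r) (hρ : 0 < ρ) :
    ∃ T > 0, ∃ η > 0, ∀ φ, IsForwardTrajectory f φ → V (φ 0) ≤ R →
      (∀ t ∈ Icc 0 T, ∀ j, j ≠ i → ρ ≤ -lieDeriv (f j) V (φ t)) →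
      V (φ 0) - V (φ T) < η → V (φ T) < r := by
  have hVc := hV.smooth.continuous
  have hS : IsCompact {x | V x ≤ R} := hVunb.isCompact_setOf_le hVc R
  obtain ⟨L, hL⟩ : ∃ L, LipschitzOnWith L (f i) {x | V x ≤ R} :=
    (((hf i).of_le (by simp)).locallyLipschitz.locallyLipschitzOn).exists_lipschitzOnWith_of_compact
      hS
  obtain ⟨M, hM0, hM⟩ : ∃ M, 0 ≤ M ∧ ∀ j, ∀ y ∈ {x | V x ≤ R}, ‖f j y - f i y‖ ≤ M := by
    choose M hM using fun j => hS.exists_bound_of_continuousOn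
      ((hf j).continuous.sub (hf i).continuous).continuousOn
    obtain ⟨B, hB⟩ := (finite_range M).bddAbove
    exact ⟨max B 0, le_max_right .., fun j y hy =>
      (hM j y hy).trans ((hB (mem_range_self j)).trans (le_max_left ..))⟩
  -- The condition on `φ 0` is duplicated so that compact induction can localize the starting point
  -- while `V (φ 0) ≤ R` is kept.
  suffices h : ∃ T > 0, ∃ η > 0, ∀ φ, IsForwardTrajectory f φ → φ 0 ∈ {x | V x ≤ R} →
      V (φ 0) ≤ R →
      (∀ t ∈ Icc 0 T, ∀ j, j ≠ i → ρ ≤ -lieDeriv (f j) V (φ t)) →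
      V (φ 0) - V (φ T) < η → V (φ T) < r by
    obtain ⟨T, hT, η, hη, h⟩ := h
    exact ⟨T, hT, η, hη, fun φ h1 h2 => h φ h1 h2 h2⟩
  refine hS.induction_on (p := fun s => ∃ T > 0, ∃ η > 0, ∀ φ, IsForwardTrajectory f φ →
    φ 0 ∈ s → V (φ 0) ≤ R → (∀ t ∈ Icc 0 T, ∀ j, j ≠ i → ρ ≤ -lieDeriv (f j) V (φ t)) →
      V (φ 0) - V (φ T) < η → V (φ T) < r) ⟨1, one_pos, 1, one_pos, by simp⟩ ?_ ?_ ?_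
  · rintro s t hst ⟨T, hT, η, hη, h⟩
    exact ⟨T, hT, η, hη, fun φ h1 h2 => h φ h1 (hst h2)⟩
  · rintro s t ⟨T, hT, η, hη, h⟩ ⟨T', hT', η', hη', h'⟩
    -- The larger time serves both pieces because `V` does not increase.
    refine ⟨max T T', by positivity, min η η', by positivity, fun φ h1 h2 h3 h4 h5 => ?_⟩
    have hle := hV.antitoneOn h1 hT.le (hT.le.trans (le_max_left T T')) (le_max_left T T')
    have hle' := hV.antitoneOn h1 hT'.le (hT'.le.trans (le_max_right T T')) (le_max_right T T')
    dsimp only at hle hle'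
    have h6 := h5.trans_le (min_le_left ..)
    have h7 := h5.trans_le (min_le_right ..)
    rcases h2 with h2 | h2
    · exact hle.trans_lt (h φ h1 h2 h3
        (fun t ht => h4 t ⟨ht.1, ht.2.trans (le_max_left ..)⟩) (by linarith))
    · exact hle'.trans_lt (h' φ h1 h2 h3
        (fun t ht => h4 t ⟨ht.1, ht.2.trans (le_max_right ..)⟩) (by linarith))
  · intro x hx
    obtain ⟨⟨ψ, hψ⟩, hlim⟩ := hi.2 x
    have hVψ : Tendsto (fun t => V (ψ t)) atTop (𝓝 0) :=
      hV.map_zero ▸ (hVc.tendsto 0).comp (hlim ψ hψ)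
    obtain ⟨T, hTr, hT⟩ := ((hVψ.eventually_lt_const hr).and (eventually_gt_atTop 0)).exists
    obtain ⟨κ, hκ, hball⟩ := Metric.mem_nhds_iff.1
      ((isOpen_lt hVc continuous_const).mem_nhds (show ψ T ∈ {y | V y < r} from hTr))
    -- One small `ε` serves as radius of initial points around `x` and as allowed drop of `V`; the
    -- shadowing error at time `T` is then below `κ`.
    have hlim0 : Tendsto (fun ε : ℝ => Real.exp ((L + 1) * T) * (M / ρ * ε + ε)) (𝓝[>] 0)
        (𝓝 0) := by
      have : Continuous fun ε : ℝ => Real.exp ((L + 1) * T) * (M / ρ * ε + ε) := by fun_prop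
      simpa using (this.tendsto 0).mono_left nhdsWithin_le_nhds
    obtain ⟨ε, hεκ, hε⟩ :=
      ((hlim0.eventually_lt_const hκ).and self_mem_nhdsWithin).exists
    replace hε : 0 < ε := hε
    refine ⟨Metric.closedBall x ε, nhdsWithin_le_nhds (Metric.closedBall_mem_nhds x hε), T, hT,
      ε, hε, fun φ h1 h2 h3 h4 h5 => hball ?_⟩
    have hψS : ∀ t, 0 ≤ t → ψ t ∈ {x | V x ≤ R} := fun t ht =>
      (hV.le_initial hψ.isForwardTrajectory ht).trans (hψ.1.symm ▸ hx)
    have := hV.norm_sub_le h1 hψ hL hρ hε hM0 hM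
      (fun t ht => (hV.le_initial h1 ht).trans h3) hψS h4 (mem_closedBall_iff_norm.1 h2)
      (right_mem_Icc.2 hT.le)
    rw [mem_ball_iff_norm]
    refine this.trans_lt (lt_of_le_of_lt ?_ hεκ)
    gcongr

end FiniteDimensional

/-! ### Separating the two fields and uniform decrease of `V` -/

section TwoVectorFields

variable {E : Type*} [NormedAddCommGroup E] [NormedSpace ℝ E] [FiniteDimensional ℝ E]
  {f : Fin 2 → E → E} {V : E → ℝ}

open scoped Manifold in
/-- On a compact set where the Lie derivatives of `V` have no common zero, a smooth function
separates the sets where each of them is small; it varies only where both are bounded away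
from zero. -/
theorem IsWeakCommonLyapunov.exists_separating (hV : IsWeakCommonLyapunov f V)
    (hf : ∀ i, ContDiff ℝ ∞ (f i)) {A : Set E} (hA : IsCompact A)
    (hK : ∀ x ∈ A, lieDeriv (f 0) V x ≠ 0 ∨ lieDeriv (f 1) V x ≠ 0) :
    ∃ ρ > 0, ∃ C ≥ 0, ∃ q : E → ℝ, Differentiable ℝ q ∧
      (∀ x ∈ A, q x ≠ 0 → ρ ≤ -lieDeriv (f 0) V x) ∧
      (∀ x ∈ A, q x ≠ 1 → ρ ≤ -lieDeriv (f 1) V x) ∧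
      ∀ x ∈ A, ∀ i, |lieDeriv (f i) q x| ≤ C * -lieDeriv (f i) V x := by
  have hW : ∀ i, Continuous fun x => -lieDeriv (f i) V x := fun i =>
    (continuous_lieDeriv (hf i).continuous hV.smooth).neg
  obtain ⟨ρ, hρ, hmax⟩ : ∃ ρ > 0, ∀ x ∈ A,
      ρ < max (-lieDeriv (f 0) V x) (-lieDeriv (f 1) V x) := by
    rcases A.eq_empty_or_nonempty with rfl | hne
    · exact ⟨1, one_pos, by simp⟩
    obtain ⟨x₀, hx₀, hmin⟩ := hA.exists_isMinOn hne ((hW 0).max (hW 1)).continuousOn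
    have hpos : 0 < max (-lieDeriv (f 0) V x₀) (-lieDeriv (f 1) V x₀) := by
      rw [lt_max_iff, neg_pos, neg_pos]
      exact (hK x₀ hx₀).imp (hV.lieDeriv_nonpos 0 x₀).lt_of_ne (hV.lieDeriv_nonpos 1 x₀).lt_of_ne
    exact ⟨_, half_pos hpos, fun x hx => (half_lt_self hpos).trans_le (hmin hx)⟩
  have hclosed : ∀ i, IsClosed (A ∩ {x | -lieDeriv (f i) V x ≤ ρ}) := fun i =>
    hA.isClosed.inter (isClosed_le (hW i) continuous_const)
  obtain ⟨q, hq, hrange, hq0, hq1⟩ :=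
    exists_contMDiff_zero_iff_one_iff_of_isClosed (n := ⊤) 𝓘(ℝ, E) (hclosed 0) (hclosed 1)
      (disjoint_left.2 fun x h0 h1 => (hmax x h0.1).not_ge (max_le h0.2 h1.2))
  replace hq : ContDiff ℝ ∞ q := hq.contDiff
  have hq0' : ∀ x ∈ A, q x ≠ 0 → ρ ≤ -lieDeriv (f 0) V x := fun x hx h =>
    le_of_not_ge fun h' => h ((hq0 x).1 ⟨hx, h'⟩)
  have hq1' : ∀ x ∈ A, q x ≠ 1 → ρ ≤ -lieDeriv (f 1) V x := fun x hx h =>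
    le_of_not_ge fun h' => h ((hq1 x).1 ⟨hx, h'⟩)
  choose M hM using fun i => hA.exists_bound_of_continuousOn
    (continuous_lieDeriv (hf i).continuous hq).continuousOn
  obtain ⟨B, hB⟩ := (finite_range M).bddAbove
  refine ⟨ρ, hρ, max B 0 / ρ, by positivity, q, hq.differentiable (by simp), hq0', hq1',
    fun x hx i => ?_⟩
  have hWi : 0 ≤ -lieDeriv (f i) V x := neg_nonneg.2 (hV.lieDeriv_nonpos i x)
  have hmem : ∀ y, q y ∈ Icc (0 : ℝ) 1 := fun y => hrange (mem_range_self y)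
  -- Where `q` is 0 or 1 it is extremal, so its differential vanishes; elsewhere both fields
  -- decrease `V` at rate at least `ρ`, whence the constant `max B 0 / ρ`.
  by_cases h0 : q x = 0
  · have : fderiv ℝ q x = 0 := IsLocalMin.fderiv_eq_zero
      (Eventually.of_forall fun y => h0.trans_le (hmem y).1)
    simp only [lieDeriv, this, zero_apply, abs_zero] at hWi ⊢
    positivity
  by_cases h1 : q x = 1
  · have : fderiv ℝ q x = 0 := IsLocalMax.fderiv_eq_zero
      (Eventually.of_forall fun y => (hmem y).2.trans_eq h1.symm)
    simp only [lieDeriv, this, zero_apply, abs_zero] at hWi ⊢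
    positivity
  have hρi : ρ ≤ -lieDeriv (f i) V x := by
    fin_cases i
    · exact hq0' x hx h0
    · exact hq1' x hx h1
  calc |lieDeriv (f i) q x| ≤ M i := hM i x hx
    _ ≤ max B 0 := (hB (mem_range_self i)).trans (le_max_left ..)
    _ = max B 0 / ρ * ρ := by field_simp
    _ ≤ _ := by gcongr

/-- Over a time interval of fixed length, `V` either falls below `r` or decreases by a fixed
amount. -/
theorem IsWeakCommonLyapunov.exists_decrease (hV : IsWeakCommonLyapunov f V)
    (hVunb : IsRadiallyUnbounded V) (hf : ∀ i, ContDiff ℝ ∞ (f i)) (hGAS : ∀ i, IsGAS (f i))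
    (hK : lieZeroSet (f 0) V ∩ lieZeroSet (f 1) V = {0}) {r : ℝ} (hr : 0 < r) (R : ℝ) :
    ∃ T > 0, ∃ η > 0, ∀ φ, IsForwardTrajectory f φ → V (φ 0) ≤ R →
      V (φ T) < r ∨ V (φ T) ≤ V (φ 0) - η := by
  have hVc := hV.smooth.continuous
  have hA : IsCompact ({x | V x ≤ R} ∩ {x | r ≤ V x}) :=
    (hVunb.isCompact_setOf_le hVc R).inter_right (isClosed_le continuous_const hVc)
  obtain ⟨ρ, hρ, C, hC, q, hq, hq0, hq1, hqC⟩ := hV.exists_separating hf hA fun x hx => by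
    by_contra! h
    have : x = 0 := (hK ▸ (⟨h.1, h.2⟩ : x ∈ lieZeroSet (f 0) V ∩ lieZeroSet (f 1) V) :
      x ∈ ({0} : Set E))
    have h2 : r ≤ V x := hx.2
    rw [this, hV.map_zero] at h2
    linarith
  obtain ⟨T₀, hT₀, η₀, hη₀, h₀⟩ :=
    hV.exists_decrease_of_isGAS (R := R) hVunb hf (hGAS 0) hr hρ
  obtain ⟨T₁, hT₁, η₁, hη₁, h₁⟩ :=
    hV.exists_decrease_of_isGAS (R := R) hVunb hf (hGAS 1) hr hρ
  -- With a drop of `V` below this value, `q` varies by less than 1/2.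
  have hη₂ : 0 < 1 / (2 * (C + 1)) := by positivity
  refine ⟨max T₀ T₁, by positivity, min (min η₀ η₁) (1 / (2 * (C + 1))), by positivity,
    fun φ hφ hR => ?_⟩
  by_contra! hcon
  obtain ⟨hcr, hcη⟩ := hcon
  have hT : 0 ≤ max T₀ T₁ := hT₀.le.trans (le_max_left ..)
  have hge : ∀ t ∈ Icc 0 (max T₀ T₁), V (φ (max T₀ T₁)) ≤ V (φ t) := fun t ht =>
    hV.antitoneOn hφ ht.1 hT ht.2
  have hmem : ∀ t ∈ Icc 0 (max T₀ T₁), φ t ∈ {x | V x ≤ R} ∩ {x | r ≤ V x} := fun t ht =>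
    ⟨(hV.le_initial hφ ht.1).trans hR, hcr.trans (hge t ht)⟩
  have hdrop : ∀ t ∈ Icc 0 (max T₀ T₁),
      V (φ 0) - V (φ t) < min (min η₀ η₁) (1 / (2 * (C + 1))) := fun t ht => by
    linarith [hge t ht]
  have hvar : ∀ t ∈ Icc 0 (max T₀ T₁), |q (φ t) - q (φ 0)| < 1 / 2 := fun t ht => by
    have h1 := hV.abs_sub_le hφ hq (fun s hs => hqC _ (hmem s (Ico_subset_Icc_self hs))) ht
    have h2 := (hdrop t ht).trans_le (min_le_right ..)
    have h3 : 0 ≤ V (φ 0) - V (φ t) := sub_nonneg.2 (hV.le_initial hφ ht.1)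
    rw [lt_div_iff₀ (by positivity)] at h2
    nlinarith
  -- If `q` starts at most 1/2 it stays below 1, so `f 1` is costly and `φ` follows `f 0`; otherwise
  -- `q` stays positive and the roles are exchanged.
  rcases le_total (q (φ 0)) (1 / 2) with hle | hle
  · have hmemT := hmem T₀ ⟨hT₀.le, le_max_left ..⟩
    refine (h₀ φ hφ hR (fun t ht j hj => ?_) ?_).not_ge hmemT.2
    · have ht' : t ∈ Icc 0 (max T₀ T₁) := ⟨ht.1, ht.2.trans (le_max_left ..)⟩
      obtain rfl : j = 1 := by omega
      exact hq1 _ (hmem t ht') (by linarith [(abs_lt.1 (hvar t ht')).2]: q (φ t) < 1).ne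
    · exact (hdrop _ ⟨hT₀.le, le_max_left ..⟩).trans_le
        ((min_le_left ..).trans (min_le_left ..))
  · have hmemT := hmem T₁ ⟨hT₁.le, le_max_right ..⟩
    refine (h₁ φ hφ hR (fun t ht j hj => ?_) ?_).not_ge hmemT.2
    · have ht' : t ∈ Icc 0 (max T₀ T₁) := ⟨ht.1, ht.2.trans (le_max_right ..)⟩
      obtain rfl : j = 0 := by omega
      exact hq0 _ (hmem t ht') (by linarith [(abs_lt.1 (hvar t ht')).1]: 0 < q (φ t)).ne'
    · exact (hdrop _ ⟨hT₁.le, le_max_right ..⟩).trans_le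
        ((min_le_left ..).trans (min_le_right ..))

theorem IsWeakCommonLyapunov.exists_time_lt (hV : IsWeakCommonLyapunov f V)
    (hVunb : IsRadiallyUnbounded V) (hf : ∀ i, ContDiff ℝ ∞ (f i)) (hGAS : ∀ i, IsGAS (f i))
    (hK : lieZeroSet (f 0) V ∩ lieZeroSet (f 1) V = {0}) {r : ℝ} (hr : 0 < r) (R : ℝ) :
    ∃ T > 0, ∀ φ, IsForwardTrajectory f φ → V (φ 0) ≤ R → ∀ t, T ≤ t → V (φ t) < r := by
  obtain ⟨T, hT, η, hη, h⟩ := hV.exists_decrease hVunb hf hGAS hK hr R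
  have hiter : ∀ n : ℕ, ∀ φ, IsForwardTrajectory f φ → V (φ 0) ≤ R →
      V (φ (n * T)) < r ∨ V (φ (n * T)) ≤ R - n * η := by
    intro n φ hφ hR
    induction n with
    | zero => right; simpa using hR
    | succ n ih =>
      have hn : 0 ≤ n * T := by positivity
      have hstep : ((n + 1 : ℕ) : ℝ) * T = T + n * T := by push_cast; ring
      have hle : V (φ (T + n * T)) ≤ V (φ (n * T)) :=
        hV.antitoneOn hφ hn (add_nonneg hT.le hn) (by linarith)
      rw [hstep]
      rcases ih with ih | ih
      · exact Or.inl (hle.trans_lt ih)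
      · refine (h _ (hφ.comp_add_const hn) ?_).imp id fun h' => ?_
        · simpa using (hV.le_initial hφ hn).trans hR
        · simp only [zero_add] at h'
          push_cast
          linarith
  obtain ⟨n, hn⟩ := exists_nat_gt (R / η)
  rw [div_lt_iff₀ hη] at hn
  -- `n + 1` rather than `n` keeps the time positive even if `R` is negative and `n = 0`.
  refine ⟨(n + 1 : ℕ) * T, by positivity, fun φ hφ hR t ht => ?_⟩
  have hT' : 0 ≤ ((n + 1 : ℕ) : ℝ) * T := by positivity
  refine (hV.antitoneOn hφ hT' (hT'.trans ht) ht).trans_lt ?_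
  rcases hiter (n + 1) φ hφ hR with h' | h'
  · exact h'
  · push_cast at h' ⊢
    exact h'.trans_lt (by linarith)

end TwoVectorFields

end SwitchedSystem

/-! ### From sublevel sets of `V` to balls -/

theorem mainTheorem8 (d : ℕ)
    (f : Fin 2 → EuclideanSpace ℝ (Fin d) → EuclideanSpace ℝ (Fin d))
    (V : EuclideanSpace ℝ (Fin d) → ℝ)
    (hf : ∀ i, ContDiff ℝ ∞ (f i))
    (hf0 : ∀ i, f i 0 = 0)
    (hV : SwitchedSystem.IsWeakCommonLyapunov f V)
    (hGAS : ∀ i, SwitchedSystem.IsGAS (f i))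
    (hVunb : SwitchedSystem.IsRadiallyUnbounded V)
    (hK : SwitchedSystem.lieZeroSet (f 0) V ∩ SwitchedSystem.lieZeroSet (f 1) V = {0}) :
    SwitchedSystem.IsGUAS f := by
  have hVc := hV.smooth.continuous
  have hex := SwitchedSystem.exists_isSwitchedSolution fun i x₀ => ((hGAS i).2 x₀).1
  refine ⟨fun δ hδ => ?_, fun ε δ hε hδ => ?_⟩
  · obtain ⟨r, hr, hrδ⟩ := hV.exists_norm_le hVunb hδ
    obtain ⟨ε, hε, hball⟩ := Metric.nhds_basis_closedBall.mem_iff.1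
      ((isOpen_lt hVc continuous_const).mem_nhds
        (show (0 : EuclideanSpace ℝ (Fin d)) ∈ {y | V y < r} from hV.map_zero.trans_lt hr))
    refine ⟨ε, hε, fun x₀ hx₀ u => ⟨hex u x₀, fun φ hφ t ht => hrδ _ ?_⟩⟩
    refine (hV.le_initial hφ.isForwardTrajectory ht).trans ?_
    rw [hφ.1]
    exact (hball (mem_closedBall_zero_iff.2 hx₀)).le
  · obtain ⟨r, hr, hrε⟩ := hV.exists_norm_le hVunb hε
    obtain ⟨R, hR⟩ := (isCompact_closedBall (0 : EuclideanSpace ℝ (Fin d)) δ).bddAbove_image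
      hVc.continuousOn
    obtain ⟨T, hT, h⟩ := hV.exists_time_lt hVunb hf hGAS hK hr R
    refine ⟨T, hT, fun x₀ hx₀ u => ⟨hex u x₀, fun φ hφ t ht => hrε _ ?_⟩⟩
    refine (h φ hφ.isForwardTrajectory ?_ t ht).le
    rw [hφ.1]
    exact hR (mem_image_of_mem V (mem_closedBall_zero_iff.2 hx₀))
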